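/- For integers $d, n \geq 0$ let $r_d(n) = |\{x \in \mathbb{Z}^d : x_1^2 + \cdots + x_d^2 = n\}|$ denote the number of representations of $n$ as an ordered sum of $d$ integer squares. Let $p$ be an odd prime. Then there exists a real constant $C > 0$ (which may depend on $p$) such that, for every odd natural number $n$, $$r_4(p^2 n) - r_4(n) \geq C n.$$ -/

import Mathlib

/-- The set `X_d(n)` of integer vectors `x ∈ ℤ^d` with `x₁² + ⋯ + x_d² = n`. -/
def sphereIntegralPoints (d n : ℕ) : Set (Fin d → ℤ) :=
  {x | ∑ i, x i ^ 2 = (n : ℤ)}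

theorem sphereIntegralPoints_finite (d n : ℕ) : (sphereIntegralPoints d n).Finite := by
  refine (Set.finite_Icc (fun _ : Fin d => -(n : ℤ)) (fun _ => (n : ℤ))).subset ?_
  intro x hx
  have hx' : ∑ i, x i ^ 2 = (n : ℤ) := hx
  have key : ∀ i, x i ^ 2 ≤ (n : ℤ) := fun i =>
    hx' ▸ Finset.single_le_sum (f := fun i => x i ^ 2) (fun j _ => sq_nonneg (x j))
      (Finset.mem_univ i)
  refine ⟨fun i => ?_, fun i => ?_⟩
  · show -(n : ℤ) ≤ x i
    nlinarith [key i, Int.le_self_sq (-(x i))]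
  · show x i ≤ (n : ℤ)
    linarith [key i, Int.le_self_sq (x i)]

/-- The representation number `r_d(n) = |X_d(n)|`: the number of representations of `n` as an
ordered sum of `d` integer squares. Since `X_d(n)` is finite (`sphereIntegralPoints_finite`),
`Set.ncard` is its true cardinality. -/
noncomputable def representationNumber (d n : ℕ) : ℕ :=
  (sphereIntegralPoints d n).ncard

/-! For odd `m`, Jacobi's theorem gives `r₄(m) = 8 σ(m)`. Every divisor of `n` is a proper divisor
of `p² n`, and `p² n` divides itself, so `σ(p² n) ≥ σ(n) + p² n` and `C = 8 p²` works. Jacobi's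
theorem is proved elementarily, by counting the points of norm `2m` in two ways. Parity and `(x, y)
↦ (x + y, x - y)` give `r₄(2m) = 3 r₄(m)`, of which `r₄(m)` points have `x + y` even. The others
split into two circles of odd radius squared, so by the two-square theorem
(`card_circlePoints_of_odd`) and Dirichlet's convolution identity
(`sum_divisorExcess_mul_divisorExcess_eq_sum_divisors`) they number `16 σ(m)`. Hence `2 r₄(m) = 16
σ(m)`. -/

/-! ### Sums of two squares. -/

/-- The integer points on the circle `x² + y² = n`. -/
noncomputable def circlePoints (n : ℕ) : Finset (ℤ × ℤ) :=
  (Finset.Icc (-(n : ℤ)) n ×ˢ Finset.Icc (-(n : ℤ)) n).filter fun z => z.1 ^ 2 + z.2 ^ 2 = (n : ℤ)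

theorem mem_circlePoints {n : ℕ} {z : ℤ × ℤ} :
    z ∈ circlePoints n ↔ z.1 ^ 2 + z.2 ^ 2 = (n : ℤ) := by
  simp only [circlePoints, Finset.mem_filter, Finset.mem_product, Finset.mem_Icc,
    and_iff_right_iff_imp]
  intro h
  have h1 := Int.le_self_sq z.1
  have h2 := Int.le_self_sq (-z.1)
  have h3 := Int.le_self_sq z.2
  have h4 := Int.le_self_sq (-z.2)
  rw [neg_sq] at h2 h4
  have h5 := sq_nonneg z.1
  have h6 := sq_nonneg z.2
  refine ⟨⟨?_, ?_⟩, ?_, ?_⟩ <;> linarith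

theorem card_circlePoints_one : (circlePoints 1).card = 4 := by decide

/-- Multiplication by the Gaussian integer `π = a + bi` of norm `p` is a bijection onto the
multiples of `π`. The divisibility condition says that `p` divides the real part of `z` times the
conjugate of `π`. -/
theorem card_circlePoints_filter_dvd {p : ℕ} (hp : p.Prime) {a b : ℤ}
    (hab : a ^ 2 + b ^ 2 = p) (n : ℕ) :
    ((circlePoints (p * n)).filter fun z => (p : ℤ) ∣ a * z.1 + b * z.2).card =
      (circlePoints n).card := by
  have hp0 : (p : ℤ) ≠ 0 := by exact_mod_cast hp.ne_zero
  have hpp : Prime (p : ℤ) := Nat.prime_iff_prime_int.mp hp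
  symm
  refine Finset.card_bij (fun z _ => (a * z.1 - b * z.2, a * z.2 + b * z.1)) ?_ ?_ ?_
  · intro z hz
    rw [mem_circlePoints] at hz
    rw [Finset.mem_filter, mem_circlePoints]
    refine ⟨?_, z.1, ?_⟩
    · push_cast
      linear_combination (a ^ 2 + b ^ 2) * hz + (n : ℤ) * hab
    · linear_combination z.1 * hab
  · rintro ⟨x, y⟩ - ⟨u, v⟩ - h
    simp only [Prod.mk.injEq] at h ⊢
    obtain ⟨h1, h2⟩ := h
    constructor
    · apply mul_left_cancel₀ hp0
      linear_combination a * h1 + b * h2 - (x - u) * hab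
    · apply mul_left_cancel₀ hp0
      linear_combination a * h2 - b * h1 - (y - v) * hab
  · rintro ⟨x, y⟩ hz
    rw [Finset.mem_filter, mem_circlePoints] at hz
    obtain ⟨hz, u, hu⟩ := hz
    push_cast at hz
    simp only at hz hu
    -- The imaginary part is then divisible by `p` too, because the squares of both parts add up to
    -- `p * (p * n)`.
    have hv : (p : ℤ) ∣ a * y - b * x := by
      have h2 : (p : ℤ) ∣ (a * y - b * x) ^ 2 := by
        refine ⟨p * n - p * u ^ 2, ?_⟩
        linear_combination (a ^ 2 + b ^ 2) * hz + p * n * hab - (a * x + b * y + p * u) * hu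
      exact hpp.dvd_of_dvd_pow h2
    obtain ⟨v, hv⟩ := hv
    refine ⟨(u, v), ?_, ?_⟩
    · rw [mem_circlePoints]
      apply mul_left_cancel₀ (pow_ne_zero 2 hp0)
      simp only
      linear_combination (a ^ 2 + b ^ 2) * hz + p * n * hab - (a * x + b * y + p * u) * hu
        - (a * y - b * x + p * v) * hv
    · simp only [Prod.mk.injEq]
      constructor
      · apply mul_left_cancel₀ hp0
        linear_combination -a * hu + b * hv + x * hab
      · apply mul_left_cancel₀ hp0
        linear_combination -a * hv - b * hu + y * hab

theorem card_circlePoints_filter_dvd_and_dvd {p : ℕ} (hp : p ≠ 0) (n : ℕ) :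
    ((circlePoints (p * (p * n))).filter fun z => (p : ℤ) ∣ z.1 ∧ (p : ℤ) ∣ z.2).card =
      (circlePoints n).card := by
  have hp0 : (p : ℤ) ≠ 0 := by exact_mod_cast hp
  symm
  refine Finset.card_bij (fun z _ => (p * z.1, p * z.2)) ?_ ?_ ?_
  · intro z hz
    rw [mem_circlePoints] at hz
    rw [Finset.mem_filter, mem_circlePoints]
    refine ⟨?_, ⟨z.1, rfl⟩, ⟨z.2, rfl⟩⟩
    push_cast
    linear_combination (p : ℤ) ^ 2 * hz
  · rintro ⟨x, y⟩ - ⟨u, v⟩ - h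
    simpa [hp] using h
  · rintro ⟨x, y⟩ hz
    rw [Finset.mem_filter, mem_circlePoints] at hz
    obtain ⟨hz, ⟨u, hu⟩, ⟨v, hv⟩⟩ := hz
    simp only at hz hu hv
    subst hu hv
    push_cast at hz
    refine ⟨(u, v), ?_, rfl⟩
    rw [mem_circlePoints]
    apply mul_left_cancel₀ (pow_ne_zero 2 hp0)
    linear_combination hz

theorem circlePoints_filter_dvd_and_dvd_eq_empty {p n : ℕ} (hp : p ≠ 0) (hn : ¬ p ∣ n) :
    ((circlePoints (p * n)).filter fun z => (p : ℤ) ∣ z.1 ∧ (p : ℤ) ∣ z.2) = ∅ := by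
  have hp0 : (p : ℤ) ≠ 0 := by exact_mod_cast hp
  refine Finset.filter_eq_empty_iff.mpr ?_
  rintro ⟨x, y⟩ hz ⟨⟨u, hu⟩, ⟨v, hv⟩⟩
  rw [mem_circlePoints] at hz
  simp only at hz hu hv
  subst hu hv
  push_cast at hz
  apply hn
  rw [← Int.natCast_dvd_natCast]
  refine ⟨u ^ 2 + v ^ 2, ?_⟩
  apply mul_left_cancel₀ hp0
  linear_combination -hz

/-- Inclusion-exclusion: `p` splits as `π` times its conjugate, a point of norm `p n` is divisible
by at least one of the two, and by both exactly when `p` divides it. -/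
theorem card_circlePoints_prime_mul_add {p : ℕ} (hp : p.Prime) (h4 : p % 4 = 1) (n : ℕ) :
    (circlePoints (p * n)).card +
      ((circlePoints (p * n)).filter fun z => (p : ℤ) ∣ z.1 ∧ (p : ℤ) ∣ z.2).card =
      2 * (circlePoints n).card := by
  have := Fact.mk hp
  obtain ⟨a, b, hab⟩ := Nat.Prime.sq_add_sq (p := p) (by omega)
  have hab : (a : ℤ) ^ 2 + (b : ℤ) ^ 2 = p := by exact_mod_cast hab
  have hab' : (a : ℤ) ^ 2 + (-(b : ℤ)) ^ 2 = p := by rw [neg_sq]; exact hab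
  have hpp : Prime (p : ℤ) := Nat.prime_iff_prime_int.mp hp
  have h0 : ∀ c e : ℤ, c ^ 2 + e ^ 2 = p → ¬ (p : ℤ) ∣ c := by
    rintro c e h hc
    have he : (p : ℤ) ∣ e := by
      refine hpp.dvd_of_dvd_pow (n := 2) ?_
      rw [show e ^ 2 = p - c * c by linear_combination h]
      exact dvd_sub dvd_rfl (hc.mul_right c)
    obtain ⟨u, rfl⟩ := hc
    obtain ⟨v, rfl⟩ := he
    have : (p : ℤ) ∣ 1 := ⟨u ^ 2 + v ^ 2, by
      apply mul_left_cancel₀ hpp.ne_zero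
      linear_combination -h⟩
    exact hpp.not_dvd_one this
  have ha := h0 a b hab
  have hb := h0 b a (by rw [add_comm]; exact hab)
  have h2 : ¬ (p : ℤ) ∣ 2 := by
    intro h
    have := Nat.le_of_dvd two_pos (by exact_mod_cast h : p ∣ 2)
    have := hp.two_le
    omega
  have e1 := card_circlePoints_filter_dvd hp hab n
  have e2 := card_circlePoints_filter_dvd hp hab' n
  have hU : ((circlePoints (p * n)).filter fun z => (p : ℤ) ∣ a * z.1 + b * z.2) ∪
      ((circlePoints (p * n)).filter fun z => (p : ℤ) ∣ a * z.1 + -b * z.2) =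
      circlePoints (p * n) := by
    rw [← Finset.filter_or]
    refine Finset.filter_true_of_mem ?_
    intro z hz
    rw [mem_circlePoints] at hz
    push_cast at hz
    apply hpp.dvd_or_dvd
    refine ⟨a ^ 2 * n - z.2 ^ 2, ?_⟩
    linear_combination (a : ℤ) ^ 2 * hz - z.2 ^ 2 * hab
  have hI : ((circlePoints (p * n)).filter fun z => (p : ℤ) ∣ a * z.1 + b * z.2) ∩
      ((circlePoints (p * n)).filter fun z => (p : ℤ) ∣ a * z.1 + -b * z.2) =
      (circlePoints (p * n)).filter fun z => (p : ℤ) ∣ z.1 ∧ (p : ℤ) ∣ z.2 := by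
    rw [← Finset.filter_and]
    refine Finset.filter_congr ?_
    intro z _
    constructor
    · rintro ⟨h, h'⟩
      have k1 : (p : ℤ) ∣ 2 * (a * z.1) := by
        have := dvd_add h h'
        rwa [show a * z.1 + b * z.2 + (a * z.1 + -b * z.2) = 2 * (a * z.1) by ring] at this
      have k2 : (p : ℤ) ∣ 2 * (b * z.2) := by
        have := dvd_sub h h'
        rwa [show a * z.1 + b * z.2 - (a * z.1 + -b * z.2) = 2 * (b * z.2) by ring] at this
      exact ⟨((hpp.dvd_or_dvd ((hpp.dvd_or_dvd k1).resolve_left h2)).resolve_left ha),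
        ((hpp.dvd_or_dvd ((hpp.dvd_or_dvd k2).resolve_left h2)).resolve_left hb)⟩
    · rintro ⟨h, h'⟩
      exact ⟨dvd_add (h.mul_left _) (h'.mul_left _), dvd_add (h.mul_left _) (h'.mul_left _)⟩
  have := Finset.card_union_add_card_inter
    ((circlePoints (p * n)).filter fun z => (p : ℤ) ∣ a * z.1 + b * z.2)
    ((circlePoints (p * n)).filter fun z => (p : ℤ) ∣ a * z.1 + -b * z.2)
  rw [hU, hI, e1, e2] at this
  omega

/-- Otherwise a quotient of the coordinates would be a square root of `-1` modulo `p`. -/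
theorem circlePoints_filter_dvd_and_dvd_eq_self {p : ℕ} (hp : p.Prime) (h4 : p % 4 = 3) (n : ℕ) :
    ((circlePoints (p * n)).filter fun z => (p : ℤ) ∣ z.1 ∧ (p : ℤ) ∣ z.2) =
      circlePoints (p * n) := by
  have := Fact.mk hp
  refine Finset.filter_true_of_mem ?_
  rintro ⟨x, y⟩ hz
  rw [mem_circlePoints] at hz
  have hz' : (x : ZMod p) ^ 2 + (y : ZMod p) ^ 2 = 0 := by
    have := congrArg (Int.cast : ℤ → ZMod p) hz
    push_cast at this
    simpa using this
  have key : ∀ u v : ZMod p, u ^ 2 + v ^ 2 = 0 → v = 0 := by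
    intro u v h
    by_contra hv
    apply ZMod.exists_sq_eq_neg_one_iff (p := p) |>.mp ?_ h4
    refine ⟨u / v, ?_⟩
    field_simp
    linear_combination -h
  simp only [← ZMod.intCast_zmod_eq_zero_iff_dvd]
  exact ⟨key y x (by rw [add_comm]; exact hz'), key x y hz'⟩

/-- The excess `∑_{d ∣ n} χ₄(d)` of divisors `1 mod 4` over divisors `3 mod 4`. -/
def divisorExcess (n : ℕ) : ℤ := ∑ d ∈ n.divisors, ZMod.χ₄ d

open scoped Pointwise in
theorem divisorExcess_prime_pow_mul {p : ℕ} (hp : p.Prime) (k : ℕ) {m : ℕ} (hm : ¬ p ∣ m) :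
    divisorExcess (p ^ k * m) =
      (∑ i ∈ Finset.range (k + 1), ZMod.χ₄ p ^ i) * divisorExcess m := by
  have hc : Nat.Coprime (p ^ k) m := ((Nat.Prime.coprime_iff_not_dvd hp).mpr hm).pow_left k
  have h := Nat.sum_divisors_prime_pow (k := k) (f := fun d : ℕ => (ZMod.χ₄ d : ℤ)) hp
  simp only [Nat.cast_pow, map_pow] at h
  unfold divisorExcess
  rw [Nat.divisors_mul, Finset.mul_def, Finset.sum_image hc.mul_injOn_divisors, ← h,
    Finset.sum_mul_sum, Finset.sum_product]
  simp only [Nat.cast_mul, map_mul]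

/-- Jacobi's two-square theorem for odd `n`. -/
theorem card_circlePoints_of_odd (n : ℕ) (hn : Odd n) :
    ((circlePoints n).card : ℤ) = 4 * divisorExcess n := by
  induction n using Nat.strong_induction_on with
  | _ n ih =>
  by_cases h1 : n = 1
  · subst h1
    rw [card_circlePoints_one]
    simp [divisorExcess]
  have hp := Nat.minFac_prime h1
  set p := n.minFac with hpdef
  obtain ⟨k, m, hm, hnk⟩ := Nat.exists_eq_pow_mul_and_not_dvd (n := n)
    (by rintro rfl; simp at hn) p hp.ne_one
  have hpo : Odd p := hn.of_dvd_nat (Nat.minFac_dvd n)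
  have hmo : Odd m := hn.of_dvd_nat ⟨_, by rw [hnk, mul_comm]⟩
  have hk : k ≠ 0 := by
    rintro rfl
    apply hm
    rw [pow_zero, one_mul] at hnk
    rw [← hnk]
    exact Nat.minFac_dvd n
  have hmn : m < n := by
    rw [hnk]
    exact lt_mul_of_one_lt_left hmo.pos (Nat.one_lt_pow hk hp.one_lt)
  -- Two consecutive exponents are carried because the recurrence has order two: with `N k` the
  -- count for `p ^ k * m`, `N (k+2) + N k = 2 N (k+1)` if `p % 4 = 1`, and `N (k+2) = N k` if `p %
  -- 4 = 3`.
  have key : ∀ k, ((circlePoints (p ^ k * m)).card : ℤ) =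
        (∑ i ∈ Finset.range (k + 1), ZMod.χ₄ p ^ i) * (circlePoints m).card ∧
      ((circlePoints (p ^ (k + 1) * m)).card : ℤ) =
        (∑ i ∈ Finset.range (k + 2), ZMod.χ₄ p ^ i) * (circlePoints m).card := by
    have hE := circlePoints_filter_dvd_and_dvd_eq_empty hp.ne_zero hm
    have h4 : p % 4 = 1 ∨ p % 4 = 3 := Nat.odd_mod_four_iff.mp (Nat.odd_iff.mp hpo)
    intro k
    induction k with
    | zero =>
      refine ⟨by simp, ?_⟩
      rw [zero_add, pow_one]
      rcases h4 with h4 | h4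
      · have := card_circlePoints_prime_mul_add hp h4 m
        rw [hE, Finset.card_empty] at this
        rw [ZMod.χ₄_nat_one_mod_four h4]
        simp
        omega
      · rw [← circlePoints_filter_dvd_and_dvd_eq_self hp h4 m, hE,
          ZMod.χ₄_nat_three_mod_four h4]
        simp [Finset.sum_range_succ]
    | succ k ih2 =>
      refine ⟨ih2.2, ?_⟩
      obtain ⟨i1, i2⟩ := ih2
      have hD := card_circlePoints_filter_dvd_and_dvd hp.ne_zero (p ^ k * m)
      have e1 : p * (p * (p ^ k * m)) = p ^ (k + 1 + 1) * m := by ring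
      have e2 : p * (p ^ k * m) = p ^ (k + 1) * m := by ring
      rw [e1] at hD
      rcases h4 with h4 | h4
      · have := card_circlePoints_prime_mul_add hp h4 (p * (p ^ k * m))
        rw [e1, hD, e2] at this
        rw [ZMod.χ₄_nat_one_mod_four h4] at i1 i2 ⊢
        simp at i1 i2 ⊢
        zify at this
        rw [i1, i2] at this
        linear_combination this
      · have := circlePoints_filter_dvd_and_dvd_eq_self hp h4 (p * (p ^ k * m))
        rw [e1] at this
        rw [← this, hD, i1, ZMod.χ₄_nat_three_mod_four h4, Finset.sum_range_succ _ (k + 2),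
          Finset.sum_range_succ _ (k + 1)]
        ring
  have := (key k).1
  rw [hnk, this, ih m hmn hmo, divisorExcess_prime_pow_mul hp k hm]
  ring

/-! ### Dirichlet's convolution identity. -/

/-- Quadruples `(d, δ, d', δ')` of odd naturals with `d δ + d' δ' = 2 m`. -/
def oddQuadruples (m : ℕ) : Finset (ℕ × ℕ × ℕ × ℕ) :=
  (Finset.range (2 * m + 1) ×ˢ Finset.range (2 * m + 1) ×ˢ Finset.range (2 * m + 1) ×ˢ
    Finset.range (2 * m + 1)).filter fun q =>
      (Odd q.1 ∧ Odd q.2.1 ∧ Odd q.2.2.1 ∧ Odd q.2.2.2) ∧ q.1 * q.2.1 + q.2.2.1 * q.2.2.2 = 2 * m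

theorem mem_oddQuadruples {m d e d' e' : ℕ} :
    (d, e, d', e') ∈ oddQuadruples m ↔
      (Odd d ∧ Odd e ∧ Odd d' ∧ Odd e') ∧ d * e + d' * e' = 2 * m := by
  simp only [oddQuadruples, Finset.mem_filter, Finset.mem_product, Finset.mem_range,
    and_iff_right_iff_imp]
  rintro ⟨⟨h1, h2, h3, h4⟩, h⟩
  have k1 := Nat.le_mul_of_pos_right d h2.pos
  have k2 := Nat.le_mul_of_pos_left e h1.pos
  have k3 := Nat.le_mul_of_pos_right d' h4.pos
  have k4 := Nat.le_mul_of_pos_left e' h3.pos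
  omega

theorem sum_divisorExcess_mul_divisorExcess (m : ℕ) :
    ∑ u ∈ (Finset.HasAntidiagonal.antidiagonal (2 * m)).filter (fun u => Odd u.1),
        divisorExcess u.1 * divisorExcess u.2 =
      ∑ q ∈ oddQuadruples m, (ZMod.χ₄ q.1 * ZMod.χ₄ q.2.2.1 : ℤ) := by
  have h : ∀ u : ℕ × ℕ, divisorExcess u.1 * divisorExcess u.2 =
      ∑ x ∈ u.1.divisorsAntidiagonal ×ˢ u.2.divisorsAntidiagonal,
        (ZMod.χ₄ x.1.1 * ZMod.χ₄ x.2.1 : ℤ) := by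
    intro u
    rw [Finset.sum_product]
    simp only
    rw [← Finset.sum_mul_sum, Nat.sum_divisorsAntidiagonal (fun d _ : ℕ => (ZMod.χ₄ d : ℤ)),
      Nat.sum_divisorsAntidiagonal (fun d _ : ℕ => (ZMod.χ₄ d : ℤ))]
    rfl
  simp only [h]
  rw [Finset.sum_sigma']
  refine Finset.sum_nbij' (fun x => (x.2.1.1, x.2.1.2, x.2.2.1, x.2.2.2))
    (fun q => ⟨(q.1 * q.2.1, q.2.2.1 * q.2.2.2), ((q.1, q.2.1), (q.2.2.1, q.2.2.2))⟩) ?_ ?_ ?_ ?_ ?_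
  · rintro ⟨⟨u, v⟩, ⟨⟨d, e⟩, ⟨d', e'⟩⟩⟩ hx
    simp only [Finset.mem_sigma, Finset.mem_filter, Finset.HasAntidiagonal.mem_antidiagonal, Finset.mem_product,
      Nat.mem_divisorsAntidiagonal] at hx
    obtain ⟨⟨h1, h2⟩, ⟨h3, -⟩, ⟨h4, -⟩⟩ := hx
    have h5 : Odd v := by
      have : Even (u + v) := h1 ▸ even_two_mul m
      rw [Nat.even_add] at this
      grind
    subst h3 h4
    rw [mem_oddQuadruples]
    rw [Nat.odd_mul] at h2 h5
    exact ⟨⟨h2.1, h2.2, h5.1, h5.2⟩, h1⟩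
  · rintro ⟨d, e, d', e'⟩ hq
    rw [mem_oddQuadruples] at hq
    obtain ⟨⟨h1, h2, h3, h4⟩, h⟩ := hq
    simp only [Finset.mem_sigma, Finset.mem_filter, Finset.HasAntidiagonal.mem_antidiagonal, Finset.mem_product,
      Nat.mem_divisorsAntidiagonal]
    exact ⟨⟨h, h1.mul h2⟩, ⟨trivial, (h1.mul h2).pos.ne'⟩, ⟨trivial, (h3.mul h4).pos.ne'⟩⟩
  · rintro ⟨⟨u, v⟩, ⟨⟨d, e⟩, ⟨d', e'⟩⟩⟩ hx
    simp only [Finset.mem_sigma, Finset.mem_filter, Finset.HasAntidiagonal.mem_antidiagonal, Finset.mem_product,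
      Nat.mem_divisorsAntidiagonal] at hx
    obtain ⟨-, ⟨rfl, -⟩, ⟨rfl, -⟩⟩ := hx
    rfl
  · rintro ⟨d, e, d', e'⟩ -
    rfl
  · rintro ⟨⟨u, v⟩, ⟨⟨d, e⟩, ⟨d', e'⟩⟩⟩ -
    rfl

/-- Parameters `(a, b, s, t, j)` with `s, t` odd, `s < 2 b`, `t < 2 a` and
`a s + b t + 2 a b j = m`: the quadruples of `oddQuadruples m` with `d' < d` are given by
`d' = t + 2 a j`, `d = d' + 2 a`, `δ = s`, `δ' = 2 b - s`. -/
def dirichletParameters (m : ℕ) : Finset (ℕ × ℕ × ℕ × ℕ × ℕ) :=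
  (Finset.range (m + 1) ×ˢ Finset.range (m + 1) ×ˢ Finset.range (m + 1) ×ˢ
    Finset.range (m + 1) ×ˢ Finset.range (m + 1)).filter fun q =>
      (Odd q.2.2.1 ∧ Odd q.2.2.2.1) ∧ (q.2.2.1 < 2 * q.2.1 ∧ q.2.2.2.1 < 2 * q.1) ∧
        q.1 * q.2.2.1 + q.2.1 * q.2.2.2.1 + 2 * (q.1 * q.2.1 * q.2.2.2.2) = m

theorem mem_dirichletParameters {m a b s t j : ℕ} :
    (a, b, s, t, j) ∈ dirichletParameters m ↔
      (Odd s ∧ Odd t) ∧ (s < 2 * b ∧ t < 2 * a) ∧ a * s + b * t + 2 * (a * b * j) = m := by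
  simp only [dirichletParameters, Finset.mem_filter, Finset.mem_product, Finset.mem_range,
    and_iff_right_iff_imp]
  rintro ⟨⟨h1, h2⟩, ⟨h3, h4⟩, h⟩
  have hb : 0 < b := by omega
  have ha : 0 < a := by omega
  have k1 := Nat.le_mul_of_pos_right a h1.pos
  have k2 := Nat.le_mul_of_pos_left s ha
  have k3 := Nat.le_mul_of_pos_right b h2.pos
  have k4 := Nat.le_mul_of_pos_left t hb
  have k5 := Nat.le_mul_of_pos_left j (Nat.mul_pos ha hb)
  omega

/-- Swapping `(a, s)` with `(b, t)` reverses the sign: as `s`, `t` and `m` are odd, `a + b` is odd.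
-/
theorem sum_dirichletParameters {m : ℕ} (hm : Odd m) :
    ∑ q ∈ dirichletParameters m, (-1 : ℤ) ^ q.1 = 0 := by
  have h : ∑ q ∈ dirichletParameters m, (-1 : ℤ) ^ q.1 =
      ∑ q ∈ dirichletParameters m, -(-1 : ℤ) ^ q.1 := by
    refine Finset.sum_nbij' (fun q => (q.2.1, q.1, q.2.2.2.1, q.2.2.1, q.2.2.2.2))
      (fun q => (q.2.1, q.1, q.2.2.2.1, q.2.2.1, q.2.2.2.2)) ?_ ?_ (fun _ _ => rfl)
      (fun _ _ => rfl) ?_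
    iterate 2
      rintro ⟨a, b, s, t, j⟩ hq
      rw [mem_dirichletParameters] at hq ⊢
      exact ⟨hq.1.symm, hq.2.1.symm, by rw [← hq.2.2]; ring⟩
    · rintro ⟨a, b, s, t, j⟩ hq
      rw [mem_dirichletParameters] at hq
      obtain ⟨⟨hs, ht⟩, -, h⟩ := hq
      have hab : Odd (a + b) := by
        rw [← h] at hm
        rw [← Nat.not_even_iff_odd] at hs ht hm ⊢
        simpa [Nat.even_add, Nat.even_mul, hs, ht] using hm
      have : (-1 : ℤ) ^ a * (-1) ^ b = -1 := by rw [← pow_add, hab.neg_one_pow]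
      rcases neg_one_pow_eq_or ℤ a with ha | ha <;> rcases neg_one_pow_eq_or ℤ b with hb | hb <;>
        simp [ha, hb] at this ⊢
  rw [Finset.sum_neg_distrib] at h
  omega

theorem χ₄_add_two_mul_mul_self {t : ℕ} (ht : Odd t) (a : ℕ) :
    (ZMod.χ₄ (t + 2 * a : ℕ) * ZMod.χ₄ t : ℤ) = (-1) ^ a := by
  have h1 : t % 2 = 1 := Nat.odd_iff.mp ht
  rw [ZMod.χ₄_eq_neg_one_pow (n := t + 2 * a) (by omega), ZMod.χ₄_eq_neg_one_pow h1,
    Nat.add_mul_div_left _ _ two_pos, pow_add, mul_right_comm, ← pow_add,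
    (Even.add_self (t / 2)).neg_one_pow, one_mul]

/-- Put `d - d' = 2 a` and `δ + δ' = 2 b`, and divide `d'` by `2 a` with remainder `t` and quotient
`j`. The summand becomes `(-1) ^ a`, and the involution on the parameters cancels everything. -/
theorem sum_oddQuadruples_filter_lt {m : ℕ} (hm : Odd m) :
    ∑ q ∈ (oddQuadruples m).filter (fun q => q.2.2.1 < q.1),
      (ZMod.χ₄ q.1 * ZMod.χ₄ q.2.2.1 : ℤ) = 0 := by
  rw [← sum_dirichletParameters hm]
  symm
  refine Finset.sum_nbij' (fun q => (q.2.2.2.1 + 2 * q.1 * q.2.2.2.2 + 2 * q.1, q.2.2.1,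
      q.2.2.2.1 + 2 * q.1 * q.2.2.2.2, 2 * q.2.1 - q.2.2.1))
    (fun q => ((q.1 - q.2.2.1) / 2, (q.2.1 + q.2.2.2) / 2, q.2.1,
      q.2.2.1 % (q.1 - q.2.2.1), q.2.2.1 / (q.1 - q.2.2.1))) ?_ ?_ ?_ ?_ ?_
  · rintro ⟨a, b, s, t, j⟩ hq
    rw [mem_dirichletParameters] at hq
    obtain ⟨⟨hs, ht⟩, ⟨h1, h2⟩, h⟩ := hq
    rw [Finset.mem_filter, mem_oddQuadruples]
    obtain ⟨c, hc⟩ : ∃ c, 2 * b = s + c := ⟨2 * b - s, by omega⟩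
    have hc' : 2 * b - s = c := by omega
    simp only [hc']
    have e1 : Odd (t + 2 * a * j) := by
      rw [mul_assoc]; exact ht.add_even (even_two_mul _)
    refine ⟨⟨⟨e1.add_even (even_two_mul _), hs, e1, ?_⟩, ?_⟩, ?_⟩
    · grind
    · have : (t + 2 * a * j + 2 * a) * s + (t + 2 * a * j) * c =
          2 * a * s + (t + 2 * a * j) * (s + c) := by ring
      rw [this, ← hc, ← h]
      ring
    · omega
  · rintro ⟨d, e, d', e'⟩ hq
    rw [Finset.mem_filter, mem_oddQuadruples] at hq
    obtain ⟨⟨⟨h1, h2, h3, h4⟩, h⟩, hlt⟩ := hq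
    rw [mem_dirichletParameters]
    simp only at hlt ⊢
    obtain ⟨a, ha⟩ : ∃ a, d - d' = 2 * a := ⟨(d - d') / 2, by grind⟩
    obtain ⟨b, hb⟩ : ∃ b, e + e' = 2 * b := ⟨(e + e') / 2, by grind⟩
    have ha' : (d - d') / 2 = a := by omega
    have hb' : (e + e') / 2 = b := by omega
    rw [ha', hb', ha]
    have hd := Nat.mod_add_div d' (2 * a)
    have hr := Nat.mod_lt d' (show 2 * a > 0 by omega)
    generalize d' % (2 * a) = t at *
    generalize d' / (2 * a) = j at *
    refine ⟨⟨h2, ?_⟩, ⟨?_, hr⟩, ?_⟩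
    · rw [← hd, mul_assoc] at h3
      grind
    · have := h4.pos
      omega
    · have hd2 : d = d' + 2 * a := by omega
      have : 2 * (a * e + b * t + 2 * (a * b * j)) = 2 * m := by
        rw [← h, hd2]
        calc _ = 2 * a * e + (t + 2 * a * j) * (2 * b) := by ring
          _ = _ := by rw [hd, ← hb]; ring
      omega
  · rintro ⟨a, b, s, t, j⟩ hq
    rw [mem_dirichletParameters] at hq
    obtain ⟨⟨hs, ht⟩, ⟨h1, h2⟩, h⟩ := hq
    have e1 : t + 2 * a * j + 2 * a - (t + 2 * a * j) = 2 * a := by omega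
    have e2 : s + (2 * b - s) = 2 * b := by omega
    simp only [e1, e2, Nat.add_mul_mod_self_left, Nat.mod_eq_of_lt h2,
      Nat.add_mul_div_left _ _ (show 0 < 2 * a by omega), Nat.div_eq_of_lt h2, zero_add,
      Nat.mul_div_cancel_left _ two_pos]
  · rintro ⟨d, e, d', e'⟩ hq
    rw [Finset.mem_filter, mem_oddQuadruples] at hq
    obtain ⟨⟨⟨h1, h2, h3, h4⟩, h⟩, hlt⟩ := hq
    simp only at hlt ⊢
    have ha : 2 * ((d - d') / 2) = d - d' := by grind
    have hb : 2 * ((e + e') / 2) = e + e' := by grind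
    rw [ha, hb, Nat.mod_add_div]
    simp only [Prod.mk.injEq, true_and]
    omega
  · rintro ⟨a, b, s, t, j⟩ hq
    rw [mem_dirichletParameters] at hq
    have e1 : Odd (t + 2 * a * j) := by
      rw [mul_assoc]; exact hq.1.2.add_even (even_two_mul _)
    exact (χ₄_add_two_mul_mul_self e1 a).symm

theorem sum_oddQuadruples_filter_gt {m : ℕ} (hm : Odd m) :
    ∑ q ∈ (oddQuadruples m).filter (fun q => q.1 < q.2.2.1),
      (ZMod.χ₄ q.1 * ZMod.χ₄ q.2.2.1 : ℤ) = 0 := by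
  rw [← sum_oddQuadruples_filter_lt hm]
  refine Finset.sum_nbij' (fun q => (q.2.2.1, q.2.2.2, q.1, q.2.1))
    (fun q => (q.2.2.1, q.2.2.2, q.1, q.2.1)) ?_ ?_ (fun _ _ => rfl) (fun _ _ => rfl)
    (fun _ _ => mul_comm _ _)
  all_goals
    rintro ⟨d, e, d', e'⟩ hq
    rw [Finset.mem_filter, mem_oddQuadruples] at hq ⊢
    obtain ⟨⟨⟨h1, h2, h3, h4⟩, h⟩, hlt⟩ := hq
    exact ⟨⟨⟨h3, h4, h1, h2⟩, by rw [← h]; ring⟩, hlt⟩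

/-- On the diagonal the summand is `χ₄(d)² = 1`. There `δ + δ' = 2 (m / d)`, so `δ = 2 i + 1` with
`i < m / d`, and the number of quadruples is the sum of `m / d` over `d ∣ m`. -/
theorem sum_oddQuadruples_filter_eq {m : ℕ} (hm : Odd m) :
    ∑ q ∈ (oddQuadruples m).filter (fun q => q.1 = q.2.2.1),
      (ZMod.χ₄ q.1 * ZMod.χ₄ q.2.2.1 : ℤ) = ∑ d ∈ m.divisors, (d : ℤ) := by
  have hσ : ∑ d ∈ m.divisors, (d : ℤ) =
      ∑ d ∈ m.divisors, ∑ _i ∈ Finset.range (m / d), (1 : ℤ) := by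
    simp only [Finset.sum_const, Finset.card_range, nsmul_eq_mul, mul_one]
    exact (Nat.sum_div_divisors m (fun d : ℕ => (d : ℤ))).symm
  rw [hσ, Finset.sum_sigma']
  refine Finset.sum_nbij' (fun q => ⟨q.1, q.2.1 / 2⟩)
    (fun x => (x.1, 2 * x.2 + 1, x.1, 2 * (m / x.1) - (2 * x.2 + 1))) ?_ ?_ ?_ ?_ ?_
  · rintro ⟨d, e, d', e'⟩ hq
    rw [Finset.mem_filter, mem_oddQuadruples] at hq
    obtain ⟨⟨⟨h1, h2, h3, h4⟩, h⟩, heq⟩ := hq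
    simp only at heq
    subst heq
    obtain ⟨b, hb⟩ : ∃ b, e + e' = 2 * b := ⟨(e + e') / 2, by grind⟩
    rw [← mul_add, hb] at h
    have hdb : d * b = m := by linarith
    have : m / d = b := by rw [← hdb, Nat.mul_div_cancel_left _ h1.pos]
    simp only [Finset.mem_sigma, Nat.mem_divisors, Finset.mem_range, this]
    have := h4.pos
    exact ⟨⟨⟨b, hdb.symm⟩, hm.pos.ne'⟩, by omega⟩
  · rintro ⟨d, i⟩ hx
    simp only [Finset.mem_sigma, Nat.mem_divisors, Finset.mem_range] at hx
    obtain ⟨⟨⟨b, rfl⟩, h0⟩, hi⟩ := hx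
    have hd : 0 < d := Nat.pos_of_ne_zero (by rintro rfl; simp at h0)
    rw [Nat.mul_div_cancel_left _ hd] at hi
    rw [Nat.odd_mul] at hm
    simp only [Finset.mem_filter, mem_oddQuadruples, Nat.mul_div_cancel_left _ hd, and_true]
    refine ⟨⟨hm.1, odd_two_mul_add_one i, hm.1, ?_⟩, ?_⟩
    · rw [Nat.odd_iff]; omega
    · rw [← mul_add, show 2 * i + 1 + (2 * b - (2 * i + 1)) = 2 * b by omega]
      ring
  · rintro ⟨d, e, d', e'⟩ hq
    rw [Finset.mem_filter, mem_oddQuadruples] at hq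
    obtain ⟨⟨⟨h1, h2, h3, h4⟩, h⟩, heq⟩ := hq
    simp only at heq
    subst heq
    obtain ⟨b, hb⟩ : ∃ b, e + e' = 2 * b := ⟨(e + e') / 2, by grind⟩
    rw [← mul_add, hb] at h
    have hdb : d * b = m := by linarith
    have : m / d = b := by rw [← hdb, Nat.mul_div_cancel_left _ h1.pos]
    have he := Nat.odd_iff.mp h2
    simp only [this, Prod.mk.injEq, true_and]
    omega
  · rintro ⟨d, i⟩ -
    have : (2 * i + 1) / 2 = i := by omega
    simp only [this]
  · rintro ⟨d, e, d', e'⟩ hq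
    rw [Finset.mem_filter, mem_oddQuadruples] at hq
    obtain ⟨⟨⟨h1, -⟩, -⟩, heq⟩ := hq
    simp only at heq
    subst heq
    simpa using χ₄_add_two_mul_mul_self h1 0

/-- Dirichlet's evaluation of the odd part of the convolution square of `divisorExcess`. -/
theorem sum_divisorExcess_mul_divisorExcess_eq_sum_divisors {m : ℕ} (hm : Odd m) :
    ∑ u ∈ (Finset.HasAntidiagonal.antidiagonal (2 * m)).filter (fun u => Odd u.1),
        divisorExcess u.1 * divisorExcess u.2 = ∑ d ∈ m.divisors, (d : ℤ) := by
  rw [sum_divisorExcess_mul_divisorExcess, ← sum_oddQuadruples_filter_eq hm,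
    ← Finset.sum_filter_add_sum_filter_not _ (fun q : ℕ × ℕ × ℕ × ℕ => q.1 = q.2.2.1)]
  have h1 := sum_oddQuadruples_filter_lt hm
  have h2 := sum_oddQuadruples_filter_gt hm
  rw [add_eq_left,
    ← Finset.sum_filter_add_sum_filter_not _ (fun q : ℕ × ℕ × ℕ × ℕ => q.1 < q.2.2.1),
    Finset.filter_filter, Finset.filter_filter]
  have e1 : ((oddQuadruples m).filter fun q => ¬ q.1 = q.2.2.1 ∧ q.1 < q.2.2.1) =
      (oddQuadruples m).filter fun q => q.1 < q.2.2.1 :=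
    Finset.filter_congr fun q _ => by omega
  have e2 : ((oddQuadruples m).filter fun q => ¬ q.1 = q.2.2.1 ∧ ¬ q.1 < q.2.2.1) =
      (oddQuadruples m).filter fun q => q.2.2.1 < q.1 :=
    Finset.filter_congr fun q _ => by omega
  rw [e1, e2, h1, h2, add_zero]

/-! ### Sums of four squares. -/

/-- The integer points on the sphere `x² + y² + z² + w² = n`. -/
noncomputable def spherePoints (n : ℕ) : Finset ((ℤ × ℤ) × ℤ × ℤ) :=
  ((Finset.Icc (-(n : ℤ)) n ×ˢ Finset.Icc (-(n : ℤ)) n) ×ˢ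
    (Finset.Icc (-(n : ℤ)) n ×ˢ Finset.Icc (-(n : ℤ)) n)).filter fun q =>
      q.1.1 ^ 2 + q.1.2 ^ 2 + (q.2.1 ^ 2 + q.2.2 ^ 2) = (n : ℤ)

theorem mem_spherePoints {n : ℕ} {x y z w : ℤ} :
    ((x, y), (z, w)) ∈ spherePoints n ↔ x ^ 2 + y ^ 2 + (z ^ 2 + w ^ 2) = (n : ℤ) := by
  simp only [spherePoints, Finset.mem_filter, Finset.mem_product, Finset.mem_Icc,
    and_iff_right_iff_imp]
  intro h
  have bound : ∀ u : ℤ, u ^ 2 ≤ n → -(n : ℤ) ≤ u ∧ u ≤ n := by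
    intro u hu
    have h1 := Int.le_self_sq u
    have h2 := Int.le_self_sq (-u)
    rw [neg_sq] at h2
    constructor <;> linarith
  have h1 := sq_nonneg x
  have h2 := sq_nonneg y
  have h3 := sq_nonneg z
  have h4 := sq_nonneg w
  exact ⟨⟨bound x (by linarith), bound y (by linarith)⟩, bound z (by linarith),
    bound w (by linarith)⟩

theorem representationNumber_four (n : ℕ) : representationNumber 4 n = (spherePoints n).card := by
  rw [representationNumber, ← Set.ncard_coe_finset]
  refine Set.ncard_congr (fun x _ => ((x 0, x 1), (x 2, x 3))) ?_ ?_ ?_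
  · intro x hx
    rw [Finset.mem_coe, mem_spherePoints]
    have hx : ∑ i, x i ^ 2 = (n : ℤ) := hx
    rw [Fin.sum_univ_four] at hx
    rw [← hx]
    ring
  · intro x y _ _ h
    simp only [Prod.mk.injEq] at h
    funext i
    fin_cases i
    exacts [h.1.1, h.1.2, h.2.1, h.2.2]
  · rintro ⟨⟨x, y⟩, ⟨z, w⟩⟩ h
    rw [Finset.mem_coe, mem_spherePoints] at h
    refine ⟨![x, y, z, w], ?_, rfl⟩
    change ∑ i, (![x, y, z, w] : Fin 4 → ℤ) i ^ 2 = (n : ℤ)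
    rw [Fin.sum_univ_four, ← h]
    simp
    ring

theorem card_spherePoints_filter_even (n : ℕ) :
    ((spherePoints (2 * n)).filter fun q => Even (q.1.1 + q.1.2)).card =
      (spherePoints n).card := by
  symm
  refine Finset.card_nbij' (fun q => ((q.1.1 + q.1.2, q.1.1 - q.1.2), (q.2.1 + q.2.2, q.2.1 - q.2.2)))
    (fun q => (((q.1.1 + q.1.2) / 2, (q.1.1 - q.1.2) / 2),
      ((q.2.1 + q.2.2) / 2, (q.2.1 - q.2.2) / 2))) ?_ ?_ ?_ ?_
  · rintro ⟨⟨x, y⟩, ⟨z, w⟩⟩ h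
    rw [Finset.mem_coe, mem_spherePoints] at h
    rw [Finset.mem_coe, Finset.mem_filter, mem_spherePoints]
    refine ⟨?_, ⟨x, by ring⟩⟩
    push_cast
    linear_combination 2 * h
  · rintro ⟨⟨x, y⟩, ⟨z, w⟩⟩ h
    rw [Finset.mem_coe, Finset.mem_filter, mem_spherePoints] at h
    rw [Finset.mem_coe, mem_spherePoints]
    obtain ⟨h, hxy⟩ := h
    have hzw : Even (z + w) := by
      have : Even (x ^ 2 + y ^ 2 + (z ^ 2 + w ^ 2)) := ⟨n, by rw [h]; push_cast; ring⟩
      simp only at hxy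
      simp only [Int.even_add, Int.even_pow] at this hxy ⊢
      tauto
    obtain ⟨u, hu⟩ := hxy
    obtain ⟨v, hv⟩ := hzw
    simp only at hu
    have e1 : (x + y) / 2 = u := by omega
    have e2 : (x - y) / 2 = u - y := by omega
    have e3 : (z + w) / 2 = v := by omega
    have e4 : (z - w) / 2 = v - w := by omega
    rw [e1, e2, e3, e4]
    obtain rfl : x = u + u - y := by omega
    obtain rfl : z = v + v - w := by omega
    push_cast at h
    linarith
  · rintro ⟨⟨x, y⟩, ⟨z, w⟩⟩ -
    simp only [Prod.mk.injEq]
    omega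
  · rintro ⟨⟨x, y⟩, ⟨z, w⟩⟩ h
    rw [Finset.mem_coe, Finset.mem_filter, mem_spherePoints] at h
    obtain ⟨h, hxy⟩ := h
    have hzw : Even (z + w) := by
      have : Even (x ^ 2 + y ^ 2 + (z ^ 2 + w ^ 2)) := ⟨n, by rw [h]; push_cast; ring⟩
      simp only at hxy
      simp only [Int.even_add, Int.even_pow] at this hxy ⊢
      tauto
    obtain ⟨u, hu⟩ := hxy
    obtain ⟨v, hv⟩ := hzw
    simp only at hu
    simp only [Prod.mk.injEq]
    omega

/-- Since `2 m` is `2` modulo `4`, exactly two coordinates are odd. So the first coordinate shares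
its parity with exactly one of the other three, and permuting coordinates makes the three cases
equinumerous. -/
theorem card_spherePoints_two_mul {m : ℕ} (hm : Odd m) :
    (spherePoints (2 * m)).card = 3 * (spherePoints m).card := by
  have e1 := card_spherePoints_filter_even m
  have e2 : ((spherePoints (2 * m)).filter fun q => Even (q.1.1 + q.2.1)).card =
      ((spherePoints (2 * m)).filter fun q => Even (q.1.1 + q.1.2)).card := by
    refine Finset.card_nbij' (fun q => ((q.1.1, q.2.1), (q.1.2, q.2.2)))
      (fun q => ((q.1.1, q.2.1), (q.1.2, q.2.2))) ?_ ?_ (fun _ _ => rfl) (fun _ _ => rfl)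
    all_goals
      rintro ⟨⟨x, y⟩, ⟨z, w⟩⟩ h
      rw [Finset.mem_coe, Finset.mem_filter, mem_spherePoints] at h ⊢
      exact ⟨by rw [← h.1]; ring, h.2⟩
  have e3 : ((spherePoints (2 * m)).filter fun q => Even (q.1.1 + q.2.2)).card =
      ((spherePoints (2 * m)).filter fun q => Even (q.1.1 + q.1.2)).card := by
    refine Finset.card_nbij' (fun q => ((q.1.1, q.2.2), (q.2.1, q.1.2)))
      (fun q => ((q.1.1, q.2.2), (q.2.1, q.1.2))) ?_ ?_ (fun _ _ => rfl) (fun _ _ => rfl)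
    all_goals
      rintro ⟨⟨x, y⟩, ⟨z, w⟩⟩ h
      rw [Finset.mem_coe, Finset.mem_filter, mem_spherePoints] at h ⊢
      exact ⟨by rw [← h.1]; ring, h.2⟩
  have key : (spherePoints (2 * m)).card =
      ((spherePoints (2 * m)).filter fun q => Even (q.1.1 + q.1.2)).card +
      ((spherePoints (2 * m)).filter fun q => Even (q.1.1 + q.2.1)).card +
      ((spherePoints (2 * m)).filter fun q => Even (q.1.1 + q.2.2)).card := by
    simp only [Finset.card_filter]
    rw [Finset.card_eq_sum_ones, ← Finset.sum_add_distrib, ← Finset.sum_add_distrib]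
    refine Finset.sum_congr rfl ?_
    rintro ⟨⟨x, y⟩, ⟨z, w⟩⟩ h
    rw [mem_spherePoints] at h
    have hmod : ∀ u : ℤ, (u % 2 = 0 ∧ u ^ 2 % 4 = 0) ∨ (u % 2 = 1 ∧ u ^ 2 % 4 = 1) := by
      intro u
      rcases Int.even_or_odd u with hu | hu
      · refine Or.inl ⟨Int.even_iff.mp hu, ?_⟩
        obtain ⟨k, rfl⟩ := hu
        rw [show (k + k) ^ 2 = 4 * k ^ 2 by ring]
        omega
      · exact Or.inr ⟨Int.odd_iff.mp hu, Int.sq_mod_four_eq_one_of_odd hu⟩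
    have hm2 := Nat.odd_iff.mp hm
    push_cast at h
    simp only [Int.even_iff]
    rcases hmod x with hx | hx <;> rcases hmod y with hy | hy <;> rcases hmod z with hz | hz <;>
      rcases hmod w with hw | hw <;> split_ifs <;> omega
  omega

/-- Fibring over `(x² + y², z² + w²)`, both odd, gives products of two circle counts; `16` is the
product of their factors `4`. -/
theorem card_spherePoints_filter_not_even {m : ℕ} (hm : Odd m) :
    (((spherePoints (2 * m)).filter fun q => ¬ Even (q.1.1 + q.1.2)).card : ℤ) =
      16 * ∑ d ∈ m.divisors, (d : ℤ) := by
  have h : ((spherePoints (2 * m)).filter fun q => ¬ Even (q.1.1 + q.1.2)).card =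
      (((Finset.HasAntidiagonal.antidiagonal (2 * m)).filter (fun u => Odd u.1)).sigma
        fun u => circlePoints u.1 ×ˢ circlePoints u.2).card := by
    refine Finset.card_nbij' (fun q => ⟨(q.1.1.natAbs ^ 2 + q.1.2.natAbs ^ 2,
      q.2.1.natAbs ^ 2 + q.2.2.natAbs ^ 2), q⟩) (fun x => x.2) ?_ ?_ (fun _ _ => rfl) ?_
    · rintro ⟨⟨x, y⟩, ⟨z, w⟩⟩ h
      rw [Finset.mem_coe, Finset.mem_filter, mem_spherePoints] at h
      simp only [Finset.mem_coe, Finset.mem_sigma, Finset.mem_filter,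
        Finset.HasAntidiagonal.mem_antidiagonal, Finset.mem_product, mem_circlePoints]
      push_cast [sq_abs]
      refine ⟨⟨?_, ?_⟩, rfl, rfl⟩
      · zify
        simp only [sq_abs]
        rw [h.1]
        push_cast
        ring
      · have := h.2
        rw [← Nat.not_even_iff_odd]
        simpa [Int.even_add, Nat.even_add, Nat.even_pow] using this
    · rintro ⟨⟨u, v⟩, ⟨⟨x, y⟩, ⟨z, w⟩⟩⟩ h
      simp only [Finset.mem_coe, Finset.mem_sigma, Finset.mem_filter,
        Finset.HasAntidiagonal.mem_antidiagonal, Finset.mem_product, mem_circlePoints] at h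
      obtain ⟨⟨h1, h2⟩, h3, h4⟩ := h
      rw [Finset.mem_coe, Finset.mem_filter, mem_spherePoints, h3, h4, ← h1]
      refine ⟨by push_cast; rfl, ?_⟩
      have h5 : ¬ Even (u : ℤ) := by
        rw [Int.even_coe_nat, Nat.not_even_iff_odd]; exact h2
      rw [← h3] at h5
      simpa [Int.even_add, Int.even_pow] using h5
    · rintro ⟨⟨u, v⟩, ⟨⟨x, y⟩, ⟨z, w⟩⟩⟩ h
      simp only [Finset.mem_coe, Finset.mem_sigma, Finset.mem_filter,
        Finset.HasAntidiagonal.mem_antidiagonal, Finset.mem_product, mem_circlePoints] at h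
      obtain ⟨-, h3, h4⟩ := h
      have e3 : x.natAbs ^ 2 + y.natAbs ^ 2 = u := by zify; simpa only [sq_abs] using h3
      have e4 : z.natAbs ^ 2 + w.natAbs ^ 2 = v := by zify; simpa only [sq_abs] using h4
      subst e3 e4
      rfl
  rw [h, Finset.card_sigma, ← sum_divisorExcess_mul_divisorExcess_eq_sum_divisors hm,
    Finset.mul_sum]
  push_cast
  refine Finset.sum_congr rfl ?_
  rintro ⟨u, v⟩ hu
  simp only [Finset.mem_filter, Finset.HasAntidiagonal.mem_antidiagonal] at hu
  have hv : Odd v := by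
    have := hu.1
    have := hu.2
    grind
  rw [Finset.card_product, Nat.cast_mul, card_circlePoints_of_odd u hu.2,
    card_circlePoints_of_odd v hv]
  ring

/-- Jacobi's four-square theorem for odd `m`. -/
theorem representationNumber_four_of_odd {m : ℕ} (hm : Odd m) :
    representationNumber 4 m = 8 * ∑ d ∈ m.divisors, d := by
  rw [representationNumber_four]
  have h1 := card_spherePoints_two_mul hm
  have h2 := card_spherePoints_filter_even m
  have h3 := card_spherePoints_filter_not_even hm
  have h4 := Finset.card_filter_add_card_filter_not (s := spherePoints (2 * m))
    (fun q => Even (q.1.1 + q.1.2))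
  have h5 : ((∑ d ∈ m.divisors, d : ℕ) : ℤ) = ∑ d ∈ m.divisors, (d : ℤ) := by push_cast; rfl
  omega

theorem proposition3p14 (p : ℕ) (hp : p.Prime) (hp_odd : Odd p) :
    ∃ C : ℝ, 0 < C ∧ ∀ n : ℕ, Odd n →
      (representationNumber 4 (p ^ 2 * n) : ℝ) - (representationNumber 4 n : ℝ) ≥ C * (n : ℝ) := by
  refine ⟨8 * p ^ 2, by have := hp.pos; positivity, fun n hn => ?_⟩
  rw [representationNumber_four_of_odd hn, representationNumber_four_of_odd (hp_odd.pow.mul hn)]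
  have hlt : n < p ^ 2 * n := lt_mul_of_one_lt_left hn.pos (Nat.one_lt_pow two_ne_zero hp.one_lt)
  -- The divisor `p ^ 2 * n` is new and alone supplies the linear gain.
  have hsub : n.divisors ⊆ (p ^ 2 * n).properDivisors := by
    intro d hd
    rw [Nat.mem_properDivisors]
    exact ⟨(Nat.dvd_of_mem_divisors hd).mul_left _, (Nat.divisor_le hd).trans_lt hlt⟩
  have hle : ∑ d ∈ n.divisors, d + p ^ 2 * n ≤ ∑ d ∈ (p ^ 2 * n).divisors, d := by
    rw [Nat.sum_divisors_eq_sum_properDivisors_add_self (n := p ^ 2 * n)]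
    exact Nat.add_le_add_right (Finset.sum_le_sum_of_subset hsub) _
  have hle : ((∑ d ∈ n.divisors, d : ℕ) : ℝ) + p ^ 2 * n ≤
      ((∑ d ∈ (p ^ 2 * n).divisors, d : ℕ) : ℝ) := by exact_mod_cast hle
  rw [Nat.cast_mul, Nat.cast_mul]
  push_cast at hle ⊢
  linarith
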